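/- **Second no-hair theorem.** Let $\mathfrak g$ be a three-dimensional solvable real Lie algebra (Bianchi types I–VII$_h$), and consider a Bianchi space-time with isometry algebra $\mathfrak g$ and line element $ds^2=-dt^2+\delta_{ab}\,\omega^a\omega^b$, where $\mathbf e_a(t)$ is a time-dependent $C^2$ basis of the Lie algebra $\mathfrak g$ of invariant vector fields, $\omega^a$ is dual to it, $\mathbf e_0=\partial_t$ and $[\mathbf e_\mu,\mathbf e_\nu]=\gamma^\rho{}_{\mu\nu}\mathbf e_\rho$. Suppose it is defined for all cosmological times $t>t_i$ and solves there Einstein's equations ($8\pi G=c=1$, no cosmological constant) $$R_{\mu\nu}-\tfrac12 R\,g_{\mu\nu}=T^{\rm pf}_{\mu\nu}+T^{\rm jf}_{\mu\nu},$$ where $T^{\rm pf}_{\mu\nu}=(\rho+p)u_\mu u_\nu+p\,g_{\mu\nu}$ is a perfect fluid comoving with $\mathbf u=\partial_t$, with $p=(\gamma-1)\rho$ and $0\le\gamma<2/3$, and $T^{\rm jf}_{\mu\nu}=\mathcal J_\mu\mathcal J_\nu-\tfrac12 g_{\mu\nu}\mathcal J_\lambda\mathcal J^\lambda$ is a $j$-form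 fluid with spatially homogeneous $\mathcal J_\mu$ (a 1-form field strength, or the Hodge dual of a 3-form field strength) satisfying $\nabla_{[\mu}\mathcal J_{\nu]}=0$ and $\nabla_\mu\mathcal J^\mu=0$; the two fluids do not interact, so $\nabla^\mu T^{\rm pf}_{\mu\nu}=0$. Let $H=\tfrac13\nabla_\mu u^\mu$ be the Hubble parameter, $\sigma_{ab}$ the shear of $\mathbf u$, and $q$ the deceleration parameter, $dH/dt=-(1+q)H^2$. Suppose that at some time $t_0>t_i$ the space-time is expanding, $H(t_0)>0$, and the fluid is present, $\rho(t_0)>0$. Then $H(t)>0$ for all $t\ge t_0$, the dimensionless time $\tau=\int_{t_0}^tH\,ds$ tends to infinity as $t\to\infty$, and the space-time is asymptotically quasi de Sitter: as $t\to\infty$, $$q\to\tfrac32\gamma-1<0,\qquad \Omega_{\rm pf}=\frac{\rho}{3H^2}\to1,\qquad \frac{\sigma_{ab}}{H}\to0,\qquad \frac{\gamma^a{}_{bc}}{H}\to0,\qquad \frac{\mathcal J_\mu}{H}\to0$$ for all spatial indices $a,b,c$ and all $\mu$. -/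

import Mathlib

open Set Filter Topology

noncomputable section

namespace Bianchi

/-! ### Geometry of a spatially homogeneous orthonormal tetrad

Index `0 : Fin 4` is the time direction and `a.succ` (for `a : Fin 3`) are the spatial directions.
All frame components below depend on cosmological time `t` only. -/

/-- The components `η_{μν} = η^{μν} = diag(-1, 1, 1, 1)` of the metric in an orthonormal tetrad. -/
def eta (μ ν : Fin 4) : ℝ := if μ = ν then (if μ = 0 then -1 else 1) else 0

/-- Action of the tetrad vector `e_μ` on a function of `t`: `e_0 = ∂/∂t`, and the spatial vectors,
being tangent to the surfaces of homogeneity, annihilate it. -/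
def frameDeriv (μ : Fin 4) (f : ℝ → ℝ) (t : ℝ) : ℝ := if μ = 0 then deriv f t else 0

/-- Structure coefficients of a tetrad: `c t ρ μ ν` is `γ^ρ_{μν}(t)` in
`[e_μ, e_ν] = γ^ρ_{μν} e_ρ`. -/
abbrev StructureCoeffs := ℝ → Fin 4 → Fin 4 → Fin 4 → ℝ

/-- Structure coefficients with the first index lowered, `γ_{ρμν}`. -/
def lowered (c : StructureCoeffs) (t : ℝ) (ρ μ ν : Fin 4) : ℝ := ∑ l, eta ρ l * c t l μ ν

/-- Levi-Civita connection of the metric for which the tetrad is orthonormal (Koszul formula):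
`∇_{e_μ} e_ν = Γ^ρ_{μν} e_ρ`, where `Γ^ρ_{μν}` is `christoffel c t ρ μ ν`. -/
def christoffel (c : StructureCoeffs) (t : ℝ) (ρ μ ν : Fin 4) : ℝ :=
  ∑ l, eta ρ l * ((lowered c t l μ ν - lowered c t μ ν l + lowered c t ν l μ) / 2)

/-- Riemann tensor `R^ρ_{σμν}`, the `ρ`-component of
`∇_{e_μ}∇_{e_ν} e_σ - ∇_{e_ν}∇_{e_μ} e_σ - ∇_{[e_μ, e_ν]} e_σ`. -/
def riemann (c : StructureCoeffs) (t : ℝ) (ρ σ μ ν : Fin 4) : ℝ :=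
  frameDeriv μ (fun s => christoffel c s ρ ν σ) t
    - frameDeriv ν (fun s => christoffel c s ρ μ σ) t
    + ∑ l, (christoffel c t l ν σ * christoffel c t ρ μ l
        - christoffel c t l μ σ * christoffel c t ρ ν l
        - c t l μ ν * christoffel c t ρ l σ)

/-- Ricci tensor `R_{σν} = R^μ_{σμν}`. -/
def ricci (c : StructureCoeffs) (t : ℝ) (σ ν : Fin 4) : ℝ := ∑ μ, riemann c t μ σ μ ν

/-- Ricci scalar. -/
def scalarCurv (c : StructureCoeffs) (t : ℝ) : ℝ := ∑ μ, ∑ ν, eta μ ν * ricci c t μ ν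

/-- Einstein tensor `R_{μν} - R g_{μν} / 2`. -/
def einstein (c : StructureCoeffs) (t : ℝ) (μ ν : Fin 4) : ℝ :=
  ricci c t μ ν - scalarCurv c t * eta μ ν / 2

/-- Covariant derivative `∇_μ J_ν` of a one-form. -/
def covDerivForm (c : StructureCoeffs) (J : ℝ → Fin 4 → ℝ) (t : ℝ) (μ ν : Fin 4) : ℝ :=
  frameDeriv μ (fun s => J s ν) t - ∑ l, christoffel c t l μ ν * J t l

/-- Covariant derivative `∇_l T_{μν}` of a covariant two-tensor. -/
def covDerivTensor (c : StructureCoeffs) (T : ℝ → Fin 4 → Fin 4 → ℝ) (t : ℝ) (l μ ν : Fin 4) : ℝ :=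
  frameDeriv l (fun s => T s μ ν) t
    - ∑ k, (christoffel c t k l μ * T t k ν + christoffel c t k l ν * T t μ k)

/-! ### Matter -/

/-- Covariant components of the four-velocity `u = ∂/∂t` of the fundamental observers. -/
def fourVelocity (μ : Fin 4) : ℝ := eta μ 0

/-- Energy-momentum tensor of the comoving perfect fluid with density `ρ` and pressure
`p = (γ - 1) ρ`. -/
def fluidStress (γ : ℝ) (ρ : ℝ → ℝ) (t : ℝ) (μ ν : Fin 4) : ℝ :=
  (ρ t + (γ - 1) * ρ t) * fourVelocity μ * fourVelocity ν + (γ - 1) * ρ t * eta μ ν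

/-- Energy-momentum tensor `J_μ J_ν - g_{μν} J_l J^l / 2` of the `j`-form. -/
def formStress (J : ℝ → Fin 4 → ℝ) (t : ℝ) (μ ν : Fin 4) : ℝ :=
  J t μ * J t ν - eta μ ν * (∑ k, ∑ l, eta k l * J t k * J t l) / 2

/-! ### Bianchi space-times -/

/-- Structure coefficients of the tetrad `e_0 = ∂/∂t`, `e_{a.succ} = e t a` on `ℝ × G`, where `𝔤` is
the Lie algebra of invariant vector fields on the three-dimensional Lie group `G` and `e t` is, for
each `t`, a basis of `𝔤`. One has `[e_b, e_c] = ⁅e t b, e t c⁆` and `[∂/∂t, e_c] = d/dt (e t c)`,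
and no commutator has a component along `∂/∂t`. -/
def structureCoeffs {𝔤 : Type*} [LieRing 𝔤] [LieAlgebra ℝ 𝔤]
    (e : ℝ → Module.Basis (Fin 3) ℝ 𝔤) : StructureCoeffs := fun t ρ μ ν =>
  Fin.cases 0 (fun a =>
    Fin.cases
      (Fin.cases 0 (fun c => deriv (fun s => (e t).repr (e s c) a) t) ν)
      (fun b => Fin.cases (-deriv (fun s => (e t).repr (e s b) a) t)
        (fun c => (e t).repr ⁅e t b, e t c⁆ a) ν) μ) ρ

/-- A solution, for all cosmological times `t > tᵢ`, of the Einstein equations (`8πG = c = 1`,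
no cosmological constant) on a Bianchi space-time whose isometry group has Lie algebra `𝔤`, with
line element `-dt² + δ_{ab} ω^a ω^b` (`ω^a` dual to the orthonormal frame `e_a`), sourced by
a comoving perfect fluid with `p = (γ - 1) ρ` and a homogeneous `j`-form `J_μ`, the two being
non-interacting. -/
structure JFormSpacetime (𝔤 : Type*) [LieRing 𝔤] [LieAlgebra ℝ 𝔤] (γ tᵢ : ℝ) where
  /-- the spatial part of the orthonormal tetrad -/
  e : ℝ → Module.Basis (Fin 3) ℝ 𝔤
  /-- the energy density of the perfect fluid -/
  ρ : ℝ → ℝ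
  /-- the tetrad components `J_μ` of the `j`-form -/
  J : ℝ → Fin 4 → ℝ
  contDiff_e : ∀ (φ : Module.Dual ℝ 𝔤) (a : Fin 3), ContDiffOn ℝ 2 (fun t => φ (e t a)) (Ioi tᵢ)
  differentiable_ρ : DifferentiableOn ℝ ρ (Ioi tᵢ)
  differentiable_J : ∀ μ, DifferentiableOn ℝ (fun t => J t μ) (Ioi tᵢ)
  /-- `R_{μν} - R g_{μν} / 2 = T^{pf}_{μν} + T^{jf}_{μν}` -/
  einstein_eq : ∀ t, tᵢ < t → ∀ μ ν,
    einstein (structureCoeffs e) t μ ν = fluidStress γ ρ t μ ν + formStress J t μ ν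
  /-- `∇^μ T^{pf}_{μν} = 0` -/
  fluid_eq : ∀ t, tᵢ < t → ∀ ν,
    ∑ l, ∑ μ, eta l μ * covDerivTensor (structureCoeffs e) (fluidStress γ ρ) t l μ ν = 0
  /-- `∇_{[μ} J_{ν]} = 0` -/
  form_closed : ∀ t, tᵢ < t → ∀ μ ν,
    covDerivForm (structureCoeffs e) J t μ ν = covDerivForm (structureCoeffs e) J t ν μ
  /-- `∇_μ J^μ = 0` -/
  form_coclosed : ∀ t, tᵢ < t →
    ∑ μ, ∑ ν, eta μ ν * covDerivForm (structureCoeffs e) J t μ ν = 0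

namespace JFormSpacetime

variable {𝔤 : Type*} [LieRing 𝔤] [LieAlgebra ℝ 𝔤] {γ tᵢ : ℝ}

/-- Hubble parameter: one third of the expansion `∇_μ u^μ` of `u = ∂/∂t`. -/
def hubble (S : JFormSpacetime 𝔤 γ tᵢ) (t : ℝ) : ℝ :=
  (∑ μ, christoffel (structureCoeffs S.e) t μ μ 0) / 3

/-- Deceleration parameter, determined by `dH/dt = -(1 + q) H²` where `H ≠ 0`. -/
def decel (S : JFormSpacetime 𝔤 γ tᵢ) (t : ℝ) : ℝ :=
  -1 - deriv S.hubble t / S.hubble t ^ 2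

/-- Shear `σ_{ab} = ∇_a u_b - H δ_{ab}` (the congruence `∂/∂t` is irrotational). -/
def shear (S : JFormSpacetime 𝔤 γ tᵢ) (t : ℝ) (a b : Fin 3) : ℝ :=
  christoffel (structureCoeffs S.e) t b.succ a.succ 0 - if a = b then S.hubble t else 0

/-- Expansion-normalized energy density `Ω_pf = ρ / (3 H²)` of the perfect fluid. -/
def omegaFluid (S : JFormSpacetime 𝔤 γ tᵢ) (t : ℝ) : ℝ := S.ρ t / (3 * S.hubble t ^ 2)

/-- The space-time is asymptotic, as `t → ∞`, to the spatially flat isotropic perfect-fluid model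
with deceleration parameter `q₀ < 0`: the expansion-normalized shear, spatial structure coefficients
and `j`-form decay, the fluid dominates (`Ω_pf → 1`), and `q → q₀`. -/
structure AsymptoticallyQuasiDeSitter (S : JFormSpacetime 𝔤 γ tᵢ) (q₀ : ℝ) : Prop where
  accelerating : q₀ < 0
  expanding : ∀ᶠ t in atTop, 0 < S.hubble t
  tendsto_decel : Tendsto S.decel atTop (𝓝 q₀)
  tendsto_omegaFluid : Tendsto S.omegaFluid atTop (𝓝 1)
  tendsto_shear : ∀ a b, Tendsto (fun t => S.shear t a b / S.hubble t) atTop (𝓝 0)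
  tendsto_structure : ∀ a b c,
    Tendsto (fun t => (S.e t).repr ⁅S.e t b, S.e t c⁆ a / S.hubble t) atTop (𝓝 0)
  tendsto_form : ∀ μ, Tendsto (fun t => S.J t μ / S.hubble t) atTop (𝓝 0)

end JFormSpacetime

end Bianchi

end

/-!
Friedmann's equation reads `3H² = ρ + |J|²/2 + |σ|²/2 - R/2`, where `R` is the scalar curvature of
the spatial sections. A solvable Lie algebra admits a nonzero linear form vanishing on all brackets,
and in dimension three this forces `R ≤ 0`; hence `|J|² + |σ|² ≤ 6H²(1 - Ω)` with `Ω = ρ / (3H²)`.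
Inserted into Raychaudhuri's equation this gives `dH/dt ≥ -3H²`, so that `H e^{3τ}` increases: `H`
stays positive and `τ → ∞`. Moreover `Ω⁻¹ - 1` decays at least like `e^{-(2 - 3γ)τ}`, so `Ω → 1` and
`σ/H`, `J/H` tend to zero. Finally the frame expands almost isotropically with rate `H`, while
`1 + q → 3γ/2 < 1`, so the structure coefficients decay faster than `H`.
-/

namespace Bianchi

/-! ### Estimates along a clock `τ` with `dτ = H dt` -/

section Clock

lemma monotoneOn_mul_exp_of_neg_mul_le_deriv {f f' τ H : ℝ → ℝ} {k T : ℝ}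
    (hf : ∀ t, T ≤ t → HasDerivAt f (f' t) t) (hτ : ∀ t, T ≤ t → HasDerivAt τ (H t) t)
    (h : ∀ t, T ≤ t → -(k * H t * f t) ≤ f' t) :
    MonotoneOn (fun t => f t * Real.exp (k * τ t)) (Ici T) := by
  have hd : ∀ t, T ≤ t → HasDerivAt (fun s => f s * Real.exp (k * τ s))
      (f' t * Real.exp (k * τ t) + f t * (Real.exp (k * τ t) * (k * H t))) t := fun t ht =>
    (hf t ht).mul ((hτ t ht).const_mul k).exp
  refine monotoneOn_of_hasDerivWithinAt_nonneg (convex_Ici T)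
    (fun t ht => (hd t ht).continuousAt.continuousWithinAt)
    (fun t ht => (hd t (interior_subset ht)).hasDerivWithinAt) fun t ht => ?_
  have hsum : 0 ≤ f' t + k * H t * f t := by linarith [h t (interior_subset ht)]
  linarith [mul_nonneg hsum (Real.exp_pos (k * τ t)).le]

lemma pos_of_neg_mul_le_deriv {f f' τ H : ℝ → ℝ} {k T t : ℝ}
    (hf : ∀ t, T ≤ t → HasDerivAt f (f' t) t) (hτ : ∀ t, T ≤ t → HasDerivAt τ (H t) t)
    (h : ∀ t, T ≤ t → -(k * H t * f t) ≤ f' t) (hT : 0 < f T) (ht : T ≤ t) : 0 < f t := by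
  have hmono := monotoneOn_mul_exp_of_neg_mul_le_deriv hf hτ h self_mem_Ici ht ht
  exact pos_of_mul_pos_left ((mul_pos hT (Real.exp_pos _)).trans_le hmono) (Real.exp_pos _).le

lemma tendsto_atTop_of_neg_sq_le_deriv {τ H H' : ℝ → ℝ} {k T : ℝ} (hk : 0 < k)
    (hτ : ∀ t, T ≤ t → HasDerivAt τ (H t) t) (hH : ∀ t, T ≤ t → HasDerivAt H (H' t) t)
    (h : ∀ t, T ≤ t → -(k * H t ^ 2) ≤ H' t) (hT : 0 < H T) : Tendsto τ atTop atTop := by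
  set c := k * (H T * Real.exp (k * τ T))
  have hc₀ : 0 < c := by positivity
  have hspeed : ∀ t, T ≤ t → c ≤ Real.exp (k * τ t) * (k * H t) := fun t ht => by
    have := monotoneOn_mul_exp_of_neg_mul_le_deriv (k := k) hH hτ
      (fun s hs => by linarith [h s hs]) self_mem_Ici ht ht
    linarith [mul_le_mul_of_nonneg_left this hk.le]
  have hd : ∀ t, T ≤ t → HasDerivAt (fun s => Real.exp (k * τ s) - c * s)
      (Real.exp (k * τ t) * (k * H t) - c * 1) t := fun t ht =>
    ((hτ t ht).const_mul k).exp.fun_sub ((hasDerivAt_id' t).const_mul c)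
  have hmono : MonotoneOn (fun s => Real.exp (k * τ s) - c * s) (Ici T) :=
    monotoneOn_of_hasDerivWithinAt_nonneg (convex_Ici T)
      (fun t ht => (hd t ht).continuousAt.continuousWithinAt)
      (fun t ht => (hd t (interior_subset ht)).hasDerivWithinAt)
      fun t ht => by linarith [hspeed t (interior_subset ht)]
  have hexp : Tendsto (fun t => Real.exp (k * τ t)) atTop atTop := by
    refine tendsto_atTop_mono' _ ?_
      (tendsto_atTop_add_const_right _ (-(c * T)) (tendsto_id.const_mul_atTop hc₀))
    filter_upwards [eventually_ge_atTop T] with t ht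
    simp only [id]
    linarith [hmono self_mem_Ici ht ht, Real.exp_pos (k * τ T)]
  exact (tendsto_const_mul_atTop_of_pos hk).1 (Real.tendsto_exp_comp_atTop.1 hexp)

lemma tendsto_zero_of_deriv_le_neg_mul {f f' τ H : ℝ → ℝ} {k : ℝ} (hk : 0 < k)
    (hf : ∀ᶠ t in atTop, HasDerivAt f (f' t) t) (hτ : ∀ᶠ t in atTop, HasDerivAt τ (H t) t)
    (h : ∀ᶠ t in atTop, f' t ≤ -(k * H t * f t)) (hf₀ : ∀ᶠ t in atTop, 0 ≤ f t)
    (hlim : Tendsto τ atTop atTop) : Tendsto f atTop (𝓝 0) := by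
  obtain ⟨T, hT⟩ := eventually_atTop.1 (hf.and (hτ.and h))
  have hmono : MonotoneOn (fun t => -f t * Real.exp (k * τ t)) (Ici T) :=
    monotoneOn_mul_exp_of_neg_mul_le_deriv (fun t ht => (hT t ht).1.fun_neg)
      (fun t ht => (hT t ht).2.1) fun t ht => by linarith [(hT t ht).2.2]
  have hexp : Tendsto (fun t => f T * Real.exp (k * τ T) * Real.exp (-(k * τ t))) atTop (𝓝 0) := by
    simpa using (Real.tendsto_exp_neg_atTop_nhds_zero.comp (hlim.const_mul_atTop hk)).const_mul
      (f T * Real.exp (k * τ T))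
  refine tendsto_of_tendsto_of_tendsto_of_le_of_le' tendsto_const_nhds hexp hf₀ ?_
  filter_upwards [eventually_ge_atTop T] with t ht
  rw [Real.exp_neg, ← div_eq_mul_inv, le_div_iff₀ (Real.exp_pos _)]
  linarith [hmono self_mem_Ici ht ht]

end Clock

lemma tendsto_div_zero_of_sq_le_mul_sq {α : Type*} {l : Filter α} {f g z : α → ℝ}
    (hz : Tendsto z l (𝓝 0)) (hg : ∀ᶠ x in l, g x ≠ 0) (h : ∀ᶠ x in l, f x ^ 2 ≤ z x * g x ^ 2) :
    Tendsto (fun x => f x / g x) l (𝓝 0) := by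
  have hsq : Tendsto (fun x => (f x / g x) ^ 2) l (𝓝 0) := by
    refine tendsto_of_tendsto_of_tendsto_of_le_of_le' tendsto_const_nhds hz
      (Eventually.of_forall fun x => sq_nonneg _) ?_
    filter_upwards [hg, h] with x hgx hx
    rwa [div_pow, div_le_iff₀ (by positivity)]
  rw [tendsto_zero_iff_abs_tendsto_zero]
  simpa [Function.comp_def, Real.sqrt_sq_eq_abs] using hsq.sqrt

/-! ### Curvature of a homogeneous orthonormal tetrad -/

section Tetrad

/-- Structure coefficients of a tetrad `e_0 = ∂/∂t`, `e_a` with `[e_0, e_c] = M^a_c e_a` and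
`[e_b, e_c] = C^a_{bc} e_a`, for arbitrary arrays of functions `M` and `C`: the form taken by
`structureCoeffs` once the Lie algebra is forgotten. -/
def tetradCoeffs (M : ℝ → Fin 3 → Fin 3 → ℝ) (C : ℝ → Fin 3 → Fin 3 → Fin 3 → ℝ) :
    StructureCoeffs := fun t ρ μ ν =>
  Fin.cases 0 (fun a =>
    Fin.cases (Fin.cases 0 (fun c => M t a c) ν)
      (fun b => Fin.cases (-M t a b) (fun c => C t a b c) ν) μ) ρ

/-- The expansion tensor `θ_{ab} = ∇_a u_b` of the observers `u = ∂/∂t`, in terms of the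
coefficients `M^a_c` of `[∂/∂t, e_c] = M^a_c e_a`. -/
noncomputable def expansionTensor {ι : Type*} (M : ι → ι → ℝ) (a b : ι) : ℝ := -(M a b + M b a) / 2

/-- Scalar curvature of a left-invariant metric on a Lie group, in terms of the structure constants
`[e_b, e_c] = C^a_{bc} e_a` of an orthonormal frame. -/
noncomputable def spatialCurv {ι : Type*} [Fintype ι] (C : ι → ι → ι → ℝ) : ℝ :=
  -(∑ a, ∑ b, ∑ c, C a b c ^ 2) / 4 - (∑ a, ∑ b, ∑ c, C a b c * C b a c) / 2
    - ∑ b, (∑ a, C a a b) ^ 2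

variable (c : StructureCoeffs) (M : ℝ → Fin 3 → Fin 3 → ℝ) (C : ℝ → Fin 3 → Fin 3 → Fin 3 → ℝ)
  (t : ℝ) (a b d : Fin 3) (μ ν : Fin 4)

lemma sum_eta_mul (f : Fin 4 → ℝ) : ∑ l, eta μ l * f l = (if μ = 0 then -1 else 1) * f μ := by
  simp [eta]

lemma lowered_zero : lowered c t 0 μ ν = -c t 0 μ ν := by
  simp [lowered, sum_eta_mul]

lemma lowered_succ : lowered c t a.succ μ ν = c t a.succ μ ν := by
  simp [lowered, sum_eta_mul]

lemma christoffel_zero : christoffel c t 0 μ ν =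
    -((lowered c t 0 μ ν - lowered c t μ ν 0 + lowered c t ν 0 μ) / 2) := by
  simp [christoffel, sum_eta_mul]

lemma christoffel_succ : christoffel c t a.succ μ ν =
    (lowered c t a.succ μ ν - lowered c t μ ν a.succ + lowered c t ν a.succ μ) / 2 := by
  simp [christoffel, sum_eta_mul]

@[simp] lemma tetradCoeffs_zero : tetradCoeffs M C t 0 μ ν = 0 := rfl

@[simp] lemma tetradCoeffs_succ_zero_zero : tetradCoeffs M C t a.succ 0 0 = 0 := rfl

@[simp] lemma tetradCoeffs_succ_zero_succ : tetradCoeffs M C t a.succ 0 b.succ = M t a b := rfl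

@[simp] lemma tetradCoeffs_succ_succ_zero : tetradCoeffs M C t a.succ b.succ 0 = -M t a b := rfl

@[simp] lemma tetradCoeffs_succ_succ_succ :
    tetradCoeffs M C t a.succ b.succ d.succ = C t a b d := rfl

@[simp] lemma christoffel_tetrad_zero_zero : christoffel (tetradCoeffs M C) t 0 0 μ = 0 := by
  cases μ using Fin.cases <;> simp [christoffel_zero, lowered_zero, lowered_succ]

@[simp] lemma christoffel_tetrad_zero_right : christoffel (tetradCoeffs M C) t 0 μ 0 = 0 := by
  cases μ using Fin.cases <;> simp [christoffel_zero, lowered_zero, lowered_succ]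

@[simp] lemma christoffel_tetrad_zero_succ_succ :
    christoffel (tetradCoeffs M C) t 0 a.succ b.succ = expansionTensor (M t) a b := by
  simp only [christoffel_zero, lowered_zero, lowered_succ, tetradCoeffs_zero,
    tetradCoeffs_succ_succ_zero, tetradCoeffs_succ_zero_succ, expansionTensor]
  ring

@[simp] lemma christoffel_tetrad_succ_zero_zero :
    christoffel (tetradCoeffs M C) t a.succ 0 0 = 0 := by
  simp [christoffel_succ, lowered_zero, lowered_succ]

@[simp] lemma christoffel_tetrad_succ_zero_succ :
    christoffel (tetradCoeffs M C) t a.succ 0 b.succ = (M t a b - M t b a) / 2 := by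
  simp only [christoffel_succ, lowered_zero, lowered_succ, tetradCoeffs_zero,
    tetradCoeffs_succ_succ_zero, tetradCoeffs_succ_zero_succ]
  ring

@[simp] lemma christoffel_tetrad_succ_succ_zero :
    christoffel (tetradCoeffs M C) t a.succ b.succ 0 = expansionTensor (M t) a b := by
  simp only [christoffel_succ, lowered_zero, lowered_succ, tetradCoeffs_zero,
    tetradCoeffs_succ_succ_zero, tetradCoeffs_succ_zero_succ, expansionTensor]
  ring

@[simp] lemma christoffel_tetrad_succ_succ_succ :
    christoffel (tetradCoeffs M C) t a.succ b.succ d.succ =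
      (C t a b d - C t b d a + C t d a b) / 2 := by
  simp [christoffel_succ, lowered_succ]

lemma ricci_tetrad_zero_zero : ricci (tetradCoeffs M C) t 0 0 =
    -(∑ a, deriv (fun s => expansionTensor (M s) a a) t)
      - ∑ a, ∑ b, expansionTensor (M t) a b ^ 2 := by
  simp only [ricci, riemann, Fin.sum_univ_succ (n := 3), christoffel_tetrad_zero_zero,
    christoffel_tetrad_zero_right, christoffel_tetrad_succ_zero_zero,
    christoffel_tetrad_succ_zero_succ, christoffel_tetrad_succ_succ_zero,
    tetradCoeffs_zero, tetradCoeffs_succ_zero_zero, tetradCoeffs_succ_succ_zero, frameDeriv,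
    Fin.succ_ne_zero, if_true, if_false, Fin.sum_univ_three, deriv_const]
  simp only [expansionTensor]
  ring

lemma sum_ricci_tetrad_succ (hC : ∀ a b d, C t a b d = -C t a d b) :
    ∑ a : Fin 3, ricci (tetradCoeffs M C) t a.succ a.succ =
      ∑ a, deriv (fun s => expansionTensor (M s) a a) t
        + (∑ a, expansionTensor (M t) a a) ^ 2 + spatialCurv (C t) := by
  have hdiag : ∀ a b, C t a b b = 0 := fun a b => by linarith [hC a b b]
  simp only [ricci, Fin.sum_univ_succ (n := 3), riemann, christoffel_tetrad_zero_zero,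
    christoffel_tetrad_zero_right, christoffel_tetrad_zero_succ_succ,
    christoffel_tetrad_succ_succ_succ, christoffel_tetrad_succ_zero_succ,
    christoffel_tetrad_succ_succ_zero, tetradCoeffs_zero, tetradCoeffs_succ_zero_succ,
    tetradCoeffs_succ_succ_succ, frameDeriv, Fin.succ_ne_zero, if_true, if_false, spatialCurv]
  simp only [Fin.sum_univ_three, hdiag, hC _ 1 0, hC _ 2 0, hC _ 2 1]
  simp only [expansionTensor]
  ring

lemma scalarCurv_eq : scalarCurv c t =
    -ricci c t 0 0 + ∑ a : Fin 3, ricci c t a.succ a.succ := by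
  simp only [scalarCurv, sum_eta_mul]
  simp only [Fin.sum_univ_succ (n := 3), Fin.succ_ne_zero, if_true, if_false, neg_mul, one_mul]

lemma einstein_zero_zero : einstein c t 0 0 =
    (ricci c t 0 0 + ∑ a : Fin 3, ricci c t a.succ a.succ) / 2 := by
  simp only [einstein, scalarCurv_eq, eta, if_true]
  ring

lemma ricci_zero_zero_eq_einstein : ricci c t 0 0 =
    (einstein c t 0 0 + ∑ a : Fin 3, einstein c t a.succ a.succ) / 2 := by
  simp only [einstein, scalarCurv_eq, eta, if_true, Fin.succ_ne_zero, if_false, Fin.sum_univ_three]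
  ring

end Tetrad

/-! ### Spatial curvature of solvable Lie algebras -/

open scoped Matrix in
lemma exists_cross_eq {K : Type*} [Field K] [LinearOrder K] [IsStrictOrderedRing K]
    {φ v : Fin 3 → K} (hφ : φ ≠ 0) (h : φ ⬝ᵥ v = 0) : ∃ w, φ ⨯₃ w = v := by
  have hn : φ ⬝ᵥ φ ≠ 0 := dotProduct_self_eq_zero.not.2 hφ
  refine ⟨(φ ⬝ᵥ φ)⁻¹ • (v ⨯₃ φ), ?_⟩
  rw [map_smul, cross_cross_eq_smul_sub_smul', dotProduct_comm v, h, zero_smul, sub_zero,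
    inv_smul_smul₀ hn]

open scoped Matrix in
lemma spatialCurv_nonpos {C : Fin 3 → Fin 3 → Fin 3 → ℝ} (hC : ∀ a b c, C a b c = -C a c b)
    {φ : Fin 3 → ℝ} (hφ : φ ≠ 0) (h : ∀ b c, φ ⬝ᵥ (fun a => C a b c) = 0) :
    spatialCurv C ≤ 0 := by
  have hn : 0 < φ ⬝ᵥ φ := by
    simpa using Matrix.dotProduct_star_self_pos_iff.2 hφ
  have hdiag : ∀ a b, C a b b = 0 := fun a b => by linarith [hC a b b]
  have hcol : ∀ b c, ∃ w : Fin 3 → ℝ, C 0 b c = φ 1 * w 2 - φ 2 * w 1 ∧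
      C 1 b c = φ 2 * w 0 - φ 0 * w 2 ∧ C 2 b c = φ 0 * w 1 - φ 1 * w 0 := by
    intro b c
    obtain ⟨w, hw⟩ := exists_cross_eq hφ (h b c)
    simp only [funext_iff, Fin.forall_fin_succ, cross_apply] at hw
    exact ⟨w, hw.1.symm, hw.2.1.symm, hw.2.2.1.symm⟩
  obtain ⟨x, hx₀, hx₁, hx₂⟩ := hcol 1 2
  obtain ⟨y, hy₀, hy₁, hy₂⟩ := hcol 2 0
  obtain ⟨z, hz₀, hz₁, hz₂⟩ := hcol 0 1
  -- Gauss' equation for the ideal `ker φ`: the three terms are the symmetric part of `ad φ`, its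
  -- trace, and the curvature of the ideal, which is spanned by two orthonormal vectors.
  have hgauss : (φ ⬝ᵥ φ) * spatialCurv C =
      -(∑ a, ∑ b, (∑ d, φ d * (C a d b + C b d a)) ^ 2) / 4 - (∑ d, φ d * ∑ a, C a d a) ^ 2
        - 2 * ∑ a, (φ 0 * C a 1 2 + φ 1 * C a 2 0 + φ 2 * C a 0 1) ^ 2 := by
    simp only [spatialCurv, dotProduct, Fin.sum_univ_three, hdiag, hC _ 1 0, hC _ 0 2, hC _ 2 1,
      hx₀, hx₁, hx₂, hy₀, hy₁, hy₂, hz₀, hz₁, hz₂]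
    ring
  refine nonpos_of_mul_nonpos_right ?_ hn
  have hsym : 0 ≤ ∑ a, ∑ b, (∑ d, φ d * (C a d b + C b d a)) ^ 2 := by positivity
  have hideal : 0 ≤ ∑ a, (φ 0 * C a 1 2 + φ 1 * C a 2 0 + φ 2 * C a 0 1) ^ 2 := by positivity
  linarith [sq_nonneg (∑ d, φ d * ∑ a, C a d a)]

lemma exists_dual_ne_zero_lie_eq_zero (K L : Type*) [Field K] [LieRing L] [LieAlgebra K L]
    [LieAlgebra.IsSolvable L] [Nontrivial L] :
    ∃ φ : Module.Dual K L, φ ≠ 0 ∧ ∀ x y : L, φ ⁅x, y⁆ = 0 := by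
  have hlt : (LieAlgebra.derivedSeries K L 1).toSubmodule < ⊤ := by
    simpa only [lt_top_iff_ne_top, ne_eq, LieSubmodule.toSubmodule_eq_top] using
      LieAlgebra.derivedSeries_lt_top_of_solvable K L
  obtain ⟨φ, hφ, hker⟩ := Submodule.exists_le_ker_of_lt_top _ hlt
  exact ⟨φ, hφ, fun x y => hker <|
    LieSubmodule.lie_mem_lie (LieSubmodule.mem_top x) (LieSubmodule.mem_top y)⟩


/-! ### Kinematics of a time-dependent frame -/

lemma differentiableAt_det {𝕜 n : Type*} [NontriviallyNormedField 𝕜] [Fintype n]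
    [DecidableEq n] {A : 𝕜 → Matrix n n 𝕜} {x : 𝕜}
    (hA : ∀ i j, DifferentiableAt 𝕜 (fun y => A y i j) x) :
    DifferentiableAt 𝕜 (fun y => (A y).det) x := by
  simp only [Matrix.det_apply']
  exact .fun_sum fun σ _ => (DifferentiableAt.fun_finsetProd fun i _ => hA (σ i) i).const_mul _

section Frame

variable {ι V : Type*} [AddCommGroup V] [Module ℝ V] (e : ℝ → Module.Basis ι ℝ V) {t : ℝ}

/-- The coefficients `M^a_c` of the rate of change `d e_c / dt = M^a_c e_a` of a frame. -/
noncomputable def frameRate (t : ℝ) (a c : ι) : ℝ := deriv (fun s => (e t).repr (e s c) a) t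

variable {e}

lemma differentiableAt_repr [Finite ι]
    (he : ∀ (φ : Module.Dual ℝ V) (a : ι), DifferentiableAt ℝ (fun s => φ (e s a)) t)
    (x : V) (a : ι) : DifferentiableAt ℝ (fun s => (e s).repr x a) t := by
  classical
  cases nonempty_fintype ι
  have hcramer : ∀ s, (e s).repr x a =
      (((e t).toMatrix (e s)).updateCol a ((e t).repr x)).det / ((e t).toMatrix (e s)).det := by
    intro s
    have hdet : ((e t).toMatrix (e s)).det ≠ 0 := ((e t).isUnit_det (e s)).ne_zero
    rw [eq_div_iff hdet, mul_comm, ← Matrix.cramer_apply,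
      ← (e s).toMatrix_mulVec_repr (e t) x, Matrix.cramer_eq_adjugate_mulVec,
      Matrix.mulVec_mulVec, Matrix.adjugate_mul, Matrix.smul_mulVec, Matrix.one_mulVec,
      Pi.smul_apply, smul_eq_mul]
  have hentry : ∀ i j, DifferentiableAt ℝ (fun s => (e t).toMatrix (e s) i j) t := fun i j =>
    he ((e t).coord i) j
  simp only [hcramer]
  refine (differentiableAt_det fun i j => ?_).fun_div (differentiableAt_det hentry)
    ((e t).isUnit_det (e t)).ne_zero
  rcases eq_or_ne j a with rfl | hj
  · simp
  · simpa [hj] using hentry i j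

lemma hasDerivAt_repr [Fintype ι]
    (he : ∀ (φ : Module.Dual ℝ V) (a : ι), DifferentiableAt ℝ (fun s => φ (e s a)) t)
    (x : V) (a : ι) :
    HasDerivAt (fun s => (e s).repr x a) (-∑ d, frameRate e t a d * (e t).repr x d) t := by
  classical
  have hrepr := fun d => (differentiableAt_repr he x d).hasDerivAt
  have hframe : ∀ d, HasDerivAt (fun s => (e t).repr (e s d) a) (frameRate e t a d) t :=
    fun d => (he ((e t).coord a) d).hasDerivAt
  have hsum := HasDerivAt.fun_sum (u := Finset.univ) fun d _ => (hframe d).fun_mul (hrepr d)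
  simp only [Module.Basis.sum_repr_mul_repr] at hsum
  have hzero := hsum.unique (hasDerivAt_const t _)
  simp only [Module.Basis.repr_self_apply, ite_mul, one_mul, zero_mul, Finset.sum_add_distrib,
    Finset.sum_ite_eq', Finset.mem_univ, if_true] at hzero
  exact (hrepr a).congr_deriv (eq_neg_of_add_eq_zero_right hzero)

lemma differentiableAt_frameRate [Finite ι]
    (he : ∀ (φ : Module.Dual ℝ V) (a : ι), ContDiffAt ℝ 2 (fun s => φ (e s a)) t) (a c : ι) :
    DifferentiableAt ℝ (fun s => frameRate e s a c) t := by
  cases nonempty_fintype ι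
  have heq : (fun s => frameRate e s a c) =ᶠ[𝓝 t]
      fun s => ∑ d, (e s).repr (e t d) a * deriv (fun r => (e t).repr (e r c) d) s := by
    have hnear : ∀ᶠ s in 𝓝 t, ∀ d, DifferentiableAt ℝ (fun r => (e t).repr (e r c) d) s := by
      refine eventually_all.2 fun d => ?_
      filter_upwards [(he ((e t).coord d) c).eventually (by decide)] with s hs
      exact hs.differentiableAt two_ne_zero
    filter_upwards [hnear] with s hs
    have hexpand : (fun r => (e s).repr (e r c) a) =
        fun r => ∑ d, (e s).repr (e t d) a * (e t).repr (e r c) d :=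
      funext fun r => ((e s).sum_repr_mul_repr (e t) (e r c) a).symm
    rw [frameRate, hexpand]
    exact (HasDerivAt.fun_sum fun d _ => (hs d).hasDerivAt.const_mul _).deriv
  refine DifferentiableAt.congr_of_eventuallyEq (.fun_sum fun d _ => .fun_mul ?_ ?_) heq
  · exact differentiableAt_repr (fun φ b => (he φ b).differentiableAt two_ne_zero) _ _
  · have hderiv : ContDiffAt ℝ 1 (deriv fun r => (e t).repr (e r c) d) t :=
      (he ((e t).coord d) c).derivWithin (by norm_num)
    exact hderiv.differentiableAt one_ne_zero

end Frame

section StructConst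

variable {ι 𝔤 : Type*} [LieRing 𝔤] [LieAlgebra ℝ 𝔤] (e : ℝ → Module.Basis ι ℝ 𝔤) (t : ℝ)

/-- The structure constants `C^a_{bc}` of the Lie algebra in the frame at time `t`,
`[e_b, e_c] = C^a_{bc} e_a`. -/
noncomputable def structConst (a b c : ι) : ℝ := (e t).repr ⁅e t b, e t c⁆ a

/-- The derivative of the structure constants `C` along the infinitesimal change of frame
`d e_c = M^a_c e_a`. -/
noncomputable def frameAction [Fintype ι] (M : ι → ι → ℝ) (C : ι → ι → ι → ℝ) (a b c : ι) : ℝ :=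
  ∑ d, M d b * C a d c + ∑ d, M d c * C a b d - ∑ d, M a d * C d b c

lemma structureCoeffs_eq (e : ℝ → Module.Basis (Fin 3) ℝ 𝔤) :
    structureCoeffs e = tetradCoeffs (frameRate e) (structConst e) := rfl

lemma structConst_antisymm (a b c : ι) : structConst e t a b c = -structConst e t a c b := by
  rw [structConst, structConst, ← lie_skew, map_neg, Finsupp.neg_apply]

lemma structConst_eq_sum [Fintype ι] (s : ℝ) (a b c : ι) :
    structConst e s a b c =
      ∑ p, ∑ q, (e t).repr (e s b) p * (e t).repr (e s c) q * (e s).repr ⁅e t p, e t q⁆ a := by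
  rw [structConst]
  conv_lhs => rw [← (e t).sum_repr (e s b), ← (e t).sum_repr (e s c)]
  simp only [sum_lie, lie_sum, smul_lie, lie_smul, map_sum, map_smul, Finsupp.coe_finsetSum,
    Finset.sum_apply, Finsupp.smul_apply, smul_eq_mul, Finset.mul_sum]
  rw [Finset.sum_comm]
  exact Finset.sum_congr rfl fun p _ => Finset.sum_congr rfl fun q _ => by ring

variable {e t}

lemma hasDerivAt_structConst [Fintype ι]
    (he : ∀ (φ : Module.Dual ℝ 𝔤) (a : ι), DifferentiableAt ℝ (fun s => φ (e s a)) t) (a b c : ι) :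
    HasDerivAt (fun s => structConst e s a b c)
      (frameAction (frameRate e t) (structConst e t) a b c) t := by
  classical
  have hframe : ∀ p b, HasDerivAt (fun s => (e t).repr (e s b) p) (frameRate e t p b) t :=
    fun p b => (he ((e t).coord p) b).hasDerivAt
  have hsum := HasDerivAt.fun_sum (u := Finset.univ) fun p _ =>
    HasDerivAt.fun_sum (u := Finset.univ) fun q _ =>
      ((hframe p b).fun_mul (hframe q c)).fun_mul (hasDerivAt_repr he ⁅e t p, e t q⁆ a)
  simp only [structConst_eq_sum e t _ a b c]
  refine hsum.congr_deriv ?_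
  simp only [Module.Basis.repr_self_apply, mul_ite, ite_mul, mul_one, mul_zero, one_mul, zero_mul,
    add_mul, Finset.sum_add_distrib, Finset.sum_ite_eq, Finset.mem_univ, if_true,
    Finset.sum_ite_irrel, Finset.sum_const_zero, frameAction, structConst]
  ring

lemma spatialCurv_structConst_nonpos [LieAlgebra.IsSolvable 𝔤] (e : ℝ → Module.Basis (Fin 3) ℝ 𝔤)
    (t : ℝ) : spatialCurv (structConst e t) ≤ 0 := by
  have : Nontrivial 𝔤 := (e t).repr.toEquiv.nontrivial
  obtain ⟨f, hf, hlie⟩ := exists_dual_ne_zero_lie_eq_zero ℝ 𝔤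
  refine spatialCurv_nonpos (structConst_antisymm e t) (φ := fun a => f (e t a))
    (fun h => hf ((e t).ext (congrFun h))) fun b c => ?_
  calc ∑ a, f (e t a) * structConst e t a b c = f (∑ a, structConst e t a b c • e t a) := by
        simp only [map_sum, map_smul, smul_eq_mul, mul_comm]
    _ = f ⁅e t b, e t c⁆ := congrArg f ((e t).sum_repr _)
    _ = 0 := hlie _ _

end StructConst

section Growth

variable {ι : Type*} [Fintype ι] [DecidableEq ι] {M : ι → ι → ℝ} {H δ : ℝ}

lemma abs_sum_mul_sum_add_le (hM : ∀ a b, |expansionTensor M a b - if a = b then H else 0| ≤ δ)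
    (x : ι → ℝ) :
    |∑ a, x a * ∑ b, M a b * x b + H * ∑ a, x a ^ 2| ≤ Fintype.card ι * δ * ∑ a, x a ^ 2 := by
  have hsymm : ∑ a, ∑ b, M b a * (x a * x b) = ∑ a, x a * ∑ b, M a b * x b := by
    rw [Finset.sum_comm]
    simp only [Finset.mul_sum]
    exact Finset.sum_congr rfl fun a _ => Finset.sum_congr rfl fun b _ => by ring
  have hdiag : ∑ a, ∑ b, (if a = b then H else 0) * (x a * x b) = H * ∑ a, x a ^ 2 := by
    simp [Finset.mul_sum, sq]
  have hexp : ∑ a, ∑ b, expansionTensor M a b * (x a * x b) = -∑ a, x a * ∑ b, M a b * x b := by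
    simp only [expansionTensor, div_mul_eq_mul_div, neg_mul, add_mul, ← Finset.sum_div,
      Finset.sum_neg_distrib, Finset.sum_add_distrib, hsymm]
    simp only [mul_left_comm (M _ _), ← Finset.mul_sum]
    ring
  have hform : ∑ a, x a * ∑ b, M a b * x b + H * ∑ a, x a ^ 2 =
      -∑ a, ∑ b, (expansionTensor M a b - if a = b then H else 0) * (x a * x b) := by
    simp only [sub_mul, Finset.sum_sub_distrib, hdiag, hexp]
    ring
  have hterm : ∀ a b, |(expansionTensor M a b - if a = b then H else 0) * (x a * x b)| ≤
      δ * ((x a ^ 2 + x b ^ 2) / 2) := by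
    intro a b
    rw [abs_mul]
    refine mul_le_mul (hM a b) ?_ (abs_nonneg _) ((abs_nonneg _).trans (hM a b))
    rw [abs_le]
    constructor <;> linarith [sq_nonneg (x a + x b), sq_nonneg (x a - x b)]
  calc |∑ a, x a * ∑ b, M a b * x b + H * ∑ a, x a ^ 2|
      ≤ ∑ a, ∑ b, δ * ((x a ^ 2 + x b ^ 2) / 2) := by
        rw [hform, abs_neg]
        exact (Finset.abs_sum_le_sum_abs _ _).trans <| Finset.sum_le_sum fun a _ =>
          (Finset.abs_sum_le_sum_abs _ _).trans <| Finset.sum_le_sum fun b _ => hterm a b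
    _ = Fintype.card ι * δ * ∑ a, x a ^ 2 := by
        simp only [← Finset.mul_sum, ← Finset.sum_div, Finset.sum_add_distrib, Finset.sum_const,
          Finset.card_univ, nsmul_eq_mul]
        ring

lemma sum_mul_frameAction_le
    (hM : ∀ a b, |expansionTensor M a b - if a = b then H else 0| ≤ δ) (C : ι → ι → ι → ℝ) :
    ∑ a, ∑ b, ∑ c, C a b c * frameAction M C a b c ≤
      (3 * Fintype.card ι * δ - H) * ∑ a, ∑ b, ∑ c, C a b c ^ 2 := by
  have hMT : ∀ a b, |expansionTensor (fun a b => M b a) a b - if a = b then H else 0| ≤ δ :=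
    fun a b => by simpa only [expansionTensor, add_comm] using hM a b
  have hupper : ∀ x : ι → ℝ, ∑ a, x a * ∑ d, M d a * x d ≤
      (Fintype.card ι * δ - H) * ∑ a, x a ^ 2 := fun x => by
    linarith [(abs_le.1 (abs_sum_mul_sum_add_le hMT x)).2]
  have hlower : ∀ x : ι → ℝ, -∑ a, x a * ∑ d, M a d * x d ≤
      (Fintype.card ι * δ + H) * ∑ a, x a ^ 2 := fun x => by
    linarith [(abs_le.1 (abs_sum_mul_sum_add_le hM x)).1]
  have hleft := Finset.sum_le_sum (s := Finset.univ) fun a _ =>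
    Finset.sum_le_sum (s := Finset.univ) fun c _ => hupper fun b => C a b c
  have hright := Finset.sum_le_sum (s := Finset.univ) fun a _ =>
    Finset.sum_le_sum (s := Finset.univ) fun b _ => hupper fun c => C a b c
  have hvalue := Finset.sum_le_sum (s := Finset.univ) fun b _ =>
    Finset.sum_le_sum (s := Finset.univ) fun c _ => hlower fun a => C a b c
  simp only [← Finset.mul_sum, Finset.sum_neg_distrib] at hvalue hleft hright
  have hswap : ∀ f : ι → ι → ι → ℝ, ∑ a, ∑ c, ∑ b, f a b c = ∑ a, ∑ b, ∑ c, f a b c :=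
    fun f => Finset.sum_congr rfl fun a _ => Finset.sum_comm
  have hrotate : ∀ f : ι → ι → ι → ℝ, ∑ b, ∑ c, ∑ a, f a b c = ∑ a, ∑ b, ∑ c, f a b c :=
    fun f => (hswap fun b a c => f a b c).trans Finset.sum_comm
  rw [hswap fun a b c => C a b c * ∑ d, M d b * C a d c, hswap fun a b c => C a b c ^ 2]
    at hleft
  rw [hrotate fun a b c => C a b c * ∑ d, M a d * C d b c, hrotate fun a b c => C a b c ^ 2]
    at hvalue
  simp only [frameAction, mul_add, mul_sub, Finset.sum_add_distrib, Finset.sum_sub_distrib]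
  linarith

end Growth

/-! ### Einstein's equations in terms of expansion, shear and spatial curvature -/

section Matter

variable (γ : ℝ) (ρ : ℝ → ℝ) (J : ℝ → Fin 4 → ℝ) (t : ℝ)

lemma fluidStress_zero_zero : fluidStress γ ρ t 0 0 = ρ t := by
  simp [fluidStress, fourVelocity, eta]

lemma fluidStress_succ_zero (a : Fin 3) : fluidStress γ ρ t a.succ 0 = 0 := by
  simp [fluidStress, fourVelocity, eta]

lemma fluidStress_succ_succ (a b : Fin 3) :
    fluidStress γ ρ t a.succ b.succ = if a = b then (γ - 1) * ρ t else 0 := by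
  simp [fluidStress, fourVelocity, eta]

lemma formStress_zero_zero : formStress J t 0 0 = (∑ μ, J t μ ^ 2) / 2 := by
  simp only [formStress, mul_assoc, sum_eta_mul]
  simp only [eta, Fin.sum_univ_succ (n := 3), Fin.succ_ne_zero, if_true, if_false, one_mul,
    neg_mul, ← sq]
  ring

lemma sum_formStress_succ :
    ∑ a : Fin 3, formStress J t a.succ a.succ = 2 * J t 0 ^ 2 - (∑ μ, J t μ ^ 2) / 2 := by
  simp only [formStress, mul_assoc, sum_eta_mul]
  simp only [eta, Fin.sum_univ_succ (n := 3), Fin.succ_ne_zero, if_true, if_false, one_mul,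
    neg_mul, ← sq, Fin.sum_univ_three]
  ring

end Matter

namespace JFormSpacetime

variable {𝔤 : Type*} [LieRing 𝔤] [LieAlgebra ℝ 𝔤] {γ tᵢ : ℝ} (S : JFormSpacetime 𝔤 γ tᵢ)
  {t t₀ : ℝ}

/-- The square `σ_{ab} σ^{ab}` of the shear tensor. -/
noncomputable def shearNormSq (t : ℝ) : ℝ := ∑ a, ∑ b, S.shear t a b ^ 2

/-- The Euclidean square `∑_μ J_μ²` of the `j`-form, which is twice its energy density. It differs
from the Lorentzian `J_μ J^μ` in the sign of `J_0²`. -/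
noncomputable def formNormSq (t : ℝ) : ℝ := ∑ μ, S.J t μ ^ 2

/-- The square `C_{abc} C^{abc}` of the structure constants in the orthonormal frame. -/
noncomputable def structNormSq (t : ℝ) : ℝ := ∑ a, ∑ b, ∑ c, structConst S.e t a b c ^ 2

lemma hubble_eq (t : ℝ) : S.hubble t = (∑ a, expansionTensor (frameRate S.e t) a a) / 3 := by
  rw [hubble, structureCoeffs_eq, Fin.sum_univ_succ]
  simp only [christoffel_tetrad_zero_zero, christoffel_tetrad_succ_succ_zero, zero_add]

lemma shear_eq (t : ℝ) (a b : Fin 3) : S.shear t a b =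
    expansionTensor (frameRate S.e t) a b - if a = b then S.hubble t else 0 := by
  rw [shear, structureCoeffs_eq, christoffel_tetrad_succ_succ_zero, expansionTensor,
    expansionTensor, add_comm]

lemma sum_expansionTensor_sq (t : ℝ) :
    ∑ a, ∑ b, expansionTensor (frameRate S.e t) a b ^ 2 =
      S.shearNormSq t + 3 * S.hubble t ^ 2 := by
  have hH := S.hubble_eq t
  simp only [shearNormSq, shear_eq, Fin.sum_univ_three, Fin.reduceEq, if_true, if_false] at hH ⊢
  linear_combination (-6 * S.hubble t) * hH

lemma shearNormSq_nonneg (t : ℝ) : 0 ≤ S.shearNormSq t := by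
  unfold shearNormSq
  positivity

lemma formNormSq_nonneg (t : ℝ) : 0 ≤ S.formNormSq t := by
  unfold formNormSq
  positivity

lemma structNormSq_nonneg (t : ℝ) : 0 ≤ S.structNormSq t := by
  unfold structNormSq
  positivity

lemma sq_form_le_formNormSq (t : ℝ) (μ : Fin 4) : S.J t μ ^ 2 ≤ S.formNormSq t :=
  Finset.single_le_sum (f := fun μ => S.J t μ ^ 2) (fun _ _ => sq_nonneg _) (Finset.mem_univ μ)

lemma sq_shear_le_shearNormSq (t : ℝ) (a b : Fin 3) : S.shear t a b ^ 2 ≤ S.shearNormSq t :=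
  calc S.shear t a b ^ 2 ≤ ∑ b, S.shear t a b ^ 2 :=
        Finset.single_le_sum (f := fun b => S.shear t a b ^ 2) (fun _ _ => sq_nonneg _)
          (Finset.mem_univ b)
    _ ≤ S.shearNormSq t :=
        Finset.single_le_sum (f := fun a => ∑ b, S.shear t a b ^ 2) (fun _ _ => by positivity)
          (Finset.mem_univ a)

lemma sq_structConst_le_structNormSq (t : ℝ) (a b c : Fin 3) :
    structConst S.e t a b c ^ 2 ≤ S.structNormSq t :=
  calc structConst S.e t a b c ^ 2 ≤ ∑ c, structConst S.e t a b c ^ 2 :=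
        Finset.single_le_sum (f := fun c => structConst S.e t a b c ^ 2) (fun _ _ => sq_nonneg _)
          (Finset.mem_univ c)
    _ ≤ ∑ b, ∑ c, structConst S.e t a b c ^ 2 :=
        Finset.single_le_sum (f := fun b => ∑ c, structConst S.e t a b c ^ 2)
          (fun _ _ => by positivity) (Finset.mem_univ b)
    _ ≤ S.structNormSq t :=
        Finset.single_le_sum (f := fun a => ∑ b, ∑ c, structConst S.e t a b c ^ 2)
          (fun _ _ => by positivity) (Finset.mem_univ a)

lemma ricci_zero_zero (ht : tᵢ < t) : ricci (structureCoeffs S.e) t 0 0 =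
    (3 * γ - 2) / 2 * S.ρ t + S.J t 0 ^ 2 := by
  rw [ricci_zero_zero_eq_einstein]
  simp only [S.einstein_eq t ht, Finset.sum_add_distrib, fluidStress_zero_zero,
    formStress_zero_zero, sum_formStress_succ, fluidStress_succ_succ, if_true, Fin.sum_const,
    nsmul_eq_mul]
  push_cast
  ring

lemma friedmann (ht : tᵢ < t) : 3 * S.hubble t ^ 2 =
    S.ρ t + S.formNormSq t / 2 + S.shearNormSq t / 2 - spatialCurv (structConst S.e t) / 2 := by
  have henergy := S.einstein_eq t ht 0 0
  rw [einstein_zero_zero, fluidStress_zero_zero, formStress_zero_zero, structureCoeffs_eq,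
    ricci_tetrad_zero_zero, sum_ricci_tetrad_succ _ _ _ (structConst_antisymm S.e t),
    sum_expansionTensor_sq] at henergy
  have htrace : ∑ a, expansionTensor (frameRate S.e t) a a = 3 * S.hubble t := by
    linarith [S.hubble_eq t]
  rw [htrace] at henergy
  rw [formNormSq]
  linarith

lemma shearNormSq_add_formNormSq_le (ht : tᵢ < t) (hK : spatialCurv (structConst S.e t) ≤ 0) :
    S.shearNormSq t + S.formNormSq t ≤ 2 * (3 * S.hubble t ^ 2 - S.ρ t) := by
  linarith [S.friedmann ht]

lemma hasDerivAt_hubble (ht : tᵢ < t) : HasDerivAt S.hubble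
    (-S.hubble t ^ 2 - S.shearNormSq t / 3 - (3 * γ - 2) / 6 * S.ρ t - S.J t 0 ^ 2 / 3) t := by
  have hθ : ∀ a, DifferentiableAt ℝ (fun s => expansionTensor (frameRate S.e s) a a) t := by
    intro a
    have hM := differentiableAt_frameRate
      (fun φ b => (S.contDiff_e φ b).contDiffAt (Ioi_mem_nhds ht)) a a
    exact (hM.fun_add hM).fun_neg.div_const 2
  have hsum := (HasDerivAt.fun_sum (u := Finset.univ) fun a _ => (hθ a).hasDerivAt).div_const 3
  simp only [← hubble_eq] at hsum
  have hraychaudhuri := S.ricci_zero_zero ht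
  rw [structureCoeffs_eq, ricci_tetrad_zero_zero, sum_expansionTensor_sq] at hraychaudhuri
  exact hsum.congr_deriv (by linarith)

lemma hasDerivAt_density (ht : tᵢ < t) :
    HasDerivAt S.ρ (-(3 * γ * S.hubble t * S.ρ t)) t := by
  have hderiv := (S.differentiable_ρ.differentiableAt (Ioi_mem_nhds ht)).hasDerivAt
  refine hderiv.congr_deriv ?_
  have henergy := S.fluid_eq t ht 0
  simp only [sum_eta_mul] at henergy
  simp only [structureCoeffs_eq, covDerivTensor, Fin.sum_univ_succ (n := 3), frameDeriv,
    Fin.succ_ne_zero, if_true, if_false, christoffel_tetrad_zero_succ_succ,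
    christoffel_tetrad_succ_succ_zero, christoffel_tetrad_zero_right,
    christoffel_tetrad_succ_zero_zero, fluidStress_zero_zero, fluidStress_succ_zero,
    fluidStress_succ_succ, Fin.sum_univ_three, Fin.reduceEq] at henergy
  rw [hubble_eq, Fin.sum_univ_three]
  linarith

lemma hasDerivAt_integral_hubble (ht₀ : tᵢ < t₀) (ht : tᵢ < t) :
    HasDerivAt (fun t => ∫ s in t₀..t, S.hubble s) (S.hubble t) t := by
  have hcont : ContinuousOn S.hubble (Ioi tᵢ) := fun s hs =>
    (S.hasDerivAt_hubble hs).continuousAt.continuousWithinAt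
  have hsub : uIcc t₀ t ⊆ Ioi tᵢ := fun s hs => (lt_min ht₀ ht).trans_le hs.1
  exact intervalIntegral.integral_hasDerivAt_right (hcont.mono hsub).intervalIntegrable
    (hcont.stronglyMeasurableAtFilter isOpen_Ioi t ht) (S.hasDerivAt_hubble ht).continuousAt

lemma density_pos (ht₀ : tᵢ < t₀) (hρ : 0 < S.ρ t₀) (ht : t₀ ≤ t) : 0 < S.ρ t :=
  pos_of_neg_mul_le_deriv (k := 3 * γ) (fun _ hs => S.hasDerivAt_density (ht₀.trans_le hs))
    (fun _ hs => S.hasDerivAt_integral_hubble ht₀ (ht₀.trans_le hs)) (fun _ _ => le_rfl) hρ ht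

lemma decel_eq (ht : tᵢ < t) (hH : S.hubble t ≠ 0) : S.decel t =
    (S.shearNormSq t + S.J t 0 ^ 2) / (3 * S.hubble t ^ 2) + (3 * γ - 2) / 2 * S.omegaFluid t := by
  rw [decel, (S.hasDerivAt_hubble ht).deriv, omegaFluid]
  field_simp
  ring

lemma hasDerivAt_hubble_decel (ht : tᵢ < t) (hH : S.hubble t ≠ 0) :
    HasDerivAt S.hubble (-((1 + S.decel t) * S.hubble t ^ 2)) t := by
  refine (S.hasDerivAt_hubble ht).differentiableAt.hasDerivAt.congr_deriv ?_
  rw [decel]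
  field_simp
  ring

lemma hasDerivAt_omegaFluid (ht : tᵢ < t) (hH : S.hubble t ≠ 0) : HasDerivAt S.omegaFluid
    ((2 * (1 + S.decel t) - 3 * γ) * S.hubble t * S.omegaFluid t) t := by
  have hquot := (S.hasDerivAt_density ht).fun_div
    (((S.hasDerivAt_hubble_decel ht hH).fun_pow 2).const_mul 3) (by positivity)
  refine hquot.congr_deriv ?_
  rw [omegaFluid]
  field_simp
  ring

lemma hasDerivAt_structNormSq (ht : tᵢ < t) : HasDerivAt S.structNormSq
    (2 * ∑ a, ∑ b, ∑ c, structConst S.e t a b c *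
      frameAction (frameRate S.e t) (structConst S.e t) a b c) t := by
  have he : ∀ (φ : Module.Dual ℝ 𝔤) (a : Fin 3), DifferentiableAt ℝ (fun s => φ (S.e s a)) t :=
    fun φ a => ((S.contDiff_e φ a).contDiffAt (Ioi_mem_nhds ht)).differentiableAt two_ne_zero
  have hsum := HasDerivAt.fun_sum (u := Finset.univ) fun a _ =>
    HasDerivAt.fun_sum (u := Finset.univ) fun b _ =>
      HasDerivAt.fun_sum (u := Finset.univ) fun c _ => (hasDerivAt_structConst he a b c).fun_pow 2
  refine hsum.congr_deriv ?_
  simp only [Finset.mul_sum, Nat.cast_ofNat, Nat.add_one_sub_one, pow_one, mul_assoc]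

lemma hasDerivAt_structNormSq_div_hubble_sq (ht : tᵢ < t) (hH : S.hubble t ≠ 0) :
    HasDerivAt (fun s => S.structNormSq s / S.hubble s ^ 2)
      (2 * (∑ a, ∑ b, ∑ c, structConst S.e t a b c *
        frameAction (frameRate S.e t) (structConst S.e t) a b c
          + (1 + S.decel t) * S.hubble t * S.structNormSq t) / S.hubble t ^ 2) t := by
  have hquot := (S.hasDerivAt_structNormSq ht).fun_div
    ((S.hasDerivAt_hubble_decel ht hH).fun_pow 2) (by positivity)
  refine hquot.congr_deriv ?_
  field_simp
  ring

/-! ### Late-time behaviour -/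

/-- A Bianchi space-time which at time `t₀` expands and contains fluid, and whose spatial sections
are non-positively curved from `t₀` on: the spatial geometry enters the late-time analysis only
through the sign of this curvature. -/
structure IsExpandingOpen (t₀ : ℝ) : Prop where
  lt : tᵢ < t₀
  hubble_pos_init : 0 < S.hubble t₀
  density_pos_init : 0 < S.ρ t₀
  spatialCurv_nonpos : ∀ t, t₀ ≤ t → spatialCurv (structConst S.e t) ≤ 0

namespace IsExpandingOpen

variable {S} (h : S.IsExpandingOpen t₀)

include h

lemma lt_of_le (ht : t₀ ≤ t) : tᵢ < t := h.lt.trans_le ht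

lemma density_pos (ht : t₀ ≤ t) : 0 < S.ρ t :=
  S.density_pos h.lt h.density_pos_init ht

lemma hasDerivAt_integral_hubble (ht : t₀ ≤ t) :
    HasDerivAt (fun t => ∫ s in t₀..t, S.hubble s) (S.hubble t) t :=
  S.hasDerivAt_integral_hubble h.lt (h.lt_of_le ht)

lemma shearNormSq_add_formNormSq_le (ht : t₀ ≤ t) :
    S.shearNormSq t + S.formNormSq t ≤ 2 * (3 * S.hubble t ^ 2 - S.ρ t) :=
  S.shearNormSq_add_formNormSq_le (h.lt_of_le ht) (h.spatialCurv_nonpos t ht)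

lemma neg_sq_le_deriv_hubble (hγ : γ ≤ 2) (ht : t₀ ≤ t) : -(3 * S.hubble t ^ 2) ≤
    -S.hubble t ^ 2 - S.shearNormSq t / 3 - (3 * γ - 2) / 6 * S.ρ t - S.J t 0 ^ 2 / 3 := by
  have hmatter := h.shearNormSq_add_formNormSq_le ht
  have hform := S.sq_form_le_formNormSq t 0
  have hfluid := mul_nonneg (sub_nonneg.2 hγ) (h.density_pos ht).le
  linarith

lemma hubble_pos (hγ : γ ≤ 2) (ht : t₀ ≤ t) : 0 < S.hubble t :=
  pos_of_neg_mul_le_deriv (k := 3) (fun _ hs => S.hasDerivAt_hubble (h.lt_of_le hs))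
    (fun _ hs => h.hasDerivAt_integral_hubble hs)
    (fun _ hs => by linarith [h.neg_sq_le_deriv_hubble hγ hs]) h.hubble_pos_init ht

lemma tendsto_integral_hubble (hγ : γ ≤ 2) :
    Tendsto (fun t => ∫ s in t₀..t, S.hubble s) atTop atTop :=
  tendsto_atTop_of_neg_sq_le_deriv three_pos (fun _ hs => h.hasDerivAt_integral_hubble hs)
    (fun _ hs => S.hasDerivAt_hubble (h.lt_of_le hs))
    (fun _ hs => h.neg_sq_le_deriv_hubble hγ hs) h.hubble_pos_init

lemma omegaFluid_pos (hγ : γ ≤ 2) (ht : t₀ ≤ t) : 0 < S.omegaFluid t :=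
  div_pos (h.density_pos ht) (mul_pos three_pos (pow_pos (h.hubble_pos hγ ht) 2))

lemma shearNormSq_add_formNormSq_le_omegaFluid (hγ : γ ≤ 2) (ht : t₀ ≤ t) :
    S.shearNormSq t + S.formNormSq t ≤ 6 * (1 - S.omegaFluid t) * S.hubble t ^ 2 := by
  have hH := h.hubble_pos hγ ht
  refine (h.shearNormSq_add_formNormSq_le ht).trans_eq ?_
  rw [omegaFluid]
  field_simp
  ring

lemma omegaFluid_le_one (hγ : γ ≤ 2) (ht : t₀ ≤ t) : S.omegaFluid t ≤ 1 := by
  have hnonneg : 0 ≤ 6 * (1 - S.omegaFluid t) * S.hubble t ^ 2 :=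
    (add_nonneg (S.shearNormSq_nonneg t) (S.formNormSq_nonneg t)).trans
      (h.shearNormSq_add_formNormSq_le_omegaFluid hγ ht)
  linarith [nonneg_of_mul_nonneg_left hnonneg (pow_pos (h.hubble_pos hγ ht) 2)]

lemma le_decel (hγ : γ ≤ 2) (ht : t₀ ≤ t) : (3 * γ - 2) / 2 * S.omegaFluid t ≤ S.decel t := by
  rw [S.decel_eq (h.lt_of_le ht) (h.hubble_pos hγ ht).ne']
  have := S.shearNormSq_nonneg t
  exact le_add_of_nonneg_left (by positivity)

lemma decel_le (hγ : γ ≤ 2) (ht : t₀ ≤ t) :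
    S.decel t ≤ 2 * (1 - S.omegaFluid t) + (3 * γ - 2) / 2 * S.omegaFluid t := by
  have hH := h.hubble_pos hγ ht
  rw [S.decel_eq (h.lt_of_le ht) hH.ne']
  refine add_le_add_left ((div_le_iff₀ (by positivity)).2 ?_) _
  linarith [h.shearNormSq_add_formNormSq_le_omegaFluid hγ ht, S.sq_form_le_formNormSq t 0]

lemma hasDerivAt_inv_omegaFluid_sub_one (hγ : γ ≤ 2) (ht : t₀ ≤ t) :
    HasDerivAt (fun t => (S.omegaFluid t)⁻¹ - 1)
      (-((2 * (1 + S.decel t) - 3 * γ) * S.hubble t * (S.omegaFluid t)⁻¹)) t := by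
  have hΩ := h.omegaFluid_pos hγ ht
  have hinv := ((S.hasDerivAt_omegaFluid (h.lt_of_le ht)
    (h.hubble_pos hγ ht).ne').fun_inv hΩ.ne').sub_const 1
  refine hinv.congr_deriv ?_
  field_simp

lemma deriv_inv_omegaFluid_le (hγ : γ ≤ 2) (ht : t₀ ≤ t) :
    -((2 * (1 + S.decel t) - 3 * γ) * S.hubble t * (S.omegaFluid t)⁻¹) ≤
      -((2 - 3 * γ) * S.hubble t * ((S.omegaFluid t)⁻¹ - 1)) := by
  have hΩ := h.omegaFluid_pos hγ ht
  have hdecel := mul_nonneg (sub_nonneg.2 (h.le_decel hγ ht))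
    (mul_pos (h.hubble_pos hγ ht) (inv_pos.2 hΩ)).le
  have hcancel : S.omegaFluid t * (S.omegaFluid t)⁻¹ = 1 := mul_inv_cancel₀ hΩ.ne'
  linear_combination 2 * hdecel + (2 - 3 * γ) * S.hubble t * hcancel

lemma tendsto_omegaFluid (hγ : γ < 2 / 3) : Tendsto S.omegaFluid atTop (𝓝 1) := by
  have hγ₂ : γ ≤ 2 := by linarith
  have hinv : Tendsto (fun t => (S.omegaFluid t)⁻¹ - 1) atTop (𝓝 0) := by
    have hlate := eventually_ge_atTop t₀
    exact tendsto_zero_of_deriv_le_neg_mul (k := 2 - 3 * γ) (by linarith)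
      (hlate.mono fun _ ht => h.hasDerivAt_inv_omegaFluid_sub_one hγ₂ ht)
      (hlate.mono fun _ ht => h.hasDerivAt_integral_hubble ht)
      (hlate.mono fun _ ht => h.deriv_inv_omegaFluid_le hγ₂ ht)
      (hlate.mono fun _ ht => sub_nonneg.2
        ((one_le_inv₀ (h.omegaFluid_pos hγ₂ ht)).2 (h.omegaFluid_le_one hγ₂ ht)))
      (h.tendsto_integral_hubble hγ₂)
  simpa using (hinv.add_const 1).inv₀ (by norm_num)

lemma tendsto_decel (hγ : γ < 2 / 3) : Tendsto S.decel atTop (𝓝 (3 / 2 * γ - 1)) := by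
  have hγ₂ : γ ≤ 2 := by linarith
  have hΩ := h.tendsto_omegaFluid hγ
  have hlower := hΩ.const_mul ((3 * γ - 2) / 2)
  have hupper := ((hΩ.const_sub 1).const_mul 2).add hlower
  rw [show (3 * γ - 2) / 2 * 1 = 3 / 2 * γ - 1 by ring] at hlower
  rw [show 2 * (1 - 1) + (3 * γ - 2) / 2 * 1 = 3 / 2 * γ - 1 by ring] at hupper
  refine tendsto_of_tendsto_of_tendsto_of_le_of_le' hlower hupper ?_ ?_ <;>
    filter_upwards [eventually_ge_atTop t₀] with t ht
  exacts [h.le_decel hγ₂ ht, h.decel_le hγ₂ ht]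

lemma tendsto_div_hubble_of_sq_le (hγ : γ < 2 / 3) {f : ℝ → ℝ}
    (hf : ∀ t, f t ^ 2 ≤ S.shearNormSq t + S.formNormSq t) :
    Tendsto (fun t => f t / S.hubble t) atTop (𝓝 0) := by
  have hγ₂ : γ ≤ 2 := by linarith
  have hz : Tendsto (fun t => 6 * (1 - S.omegaFluid t)) atTop (𝓝 0) := by
    simpa using ((h.tendsto_omegaFluid hγ).const_sub 1).const_mul 6
  refine tendsto_div_zero_of_sq_le_mul_sq hz ?_ ?_ <;>
    filter_upwards [eventually_ge_atTop t₀] with t ht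
  exacts [(h.hubble_pos hγ₂ ht).ne',
    (hf t).trans (h.shearNormSq_add_formNormSq_le_omegaFluid hγ₂ ht)]

lemma tendsto_shear_div_hubble (hγ : γ < 2 / 3) (a b : Fin 3) :
    Tendsto (fun t => S.shear t a b / S.hubble t) atTop (𝓝 0) :=
  h.tendsto_div_hubble_of_sq_le hγ fun t =>
    (S.sq_shear_le_shearNormSq t a b).trans (le_add_of_nonneg_right (S.formNormSq_nonneg t))

lemma tendsto_form_div_hubble (hγ : γ < 2 / 3) (μ : Fin 4) :
    Tendsto (fun t => S.J t μ / S.hubble t) atTop (𝓝 0) :=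
  h.tendsto_div_hubble_of_sq_le hγ fun t =>
    (S.sq_form_le_formNormSq t μ).trans (le_add_of_nonneg_left (S.shearNormSq_nonneg t))

lemma deriv_structNormSq_div_hubble_sq_le (hγ : γ ≤ 2) (ht : t₀ ≤ t) {ε : ℝ}
    (hσ : ∀ a b, |S.shear t a b| ≤ ε * S.hubble t) :
    2 * (∑ a, ∑ b, ∑ c, structConst S.e t a b c *
        frameAction (frameRate S.e t) (structConst S.e t) a b c
          + (1 + S.decel t) * S.hubble t * S.structNormSq t) / S.hubble t ^ 2 ≤
      2 * (9 * ε + S.decel t) * S.hubble t * (S.structNormSq t / S.hubble t ^ 2) := by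
  have hH := h.hubble_pos hγ ht
  simp only [shear_eq] at hσ
  have hframe := sum_mul_frameAction_le hσ (structConst S.e t)
  rw [Fintype.card_fin, ← structNormSq] at hframe
  push_cast at hframe
  rw [mul_div_assoc', div_le_div_iff_of_pos_right (by positivity)]
  linarith

lemma eventually_deriv_structNormSq_le (hγ : γ < 2 / 3) : ∀ᶠ t in atTop,
    2 * (∑ a, ∑ b, ∑ c, structConst S.e t a b c *
        frameAction (frameRate S.e t) (structConst S.e t) a b c
          + (1 + S.decel t) * S.hubble t * S.structNormSq t) / S.hubble t ^ 2 ≤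
      -((2 - 3 * γ) / 4 * S.hubble t * (S.structNormSq t / S.hubble t ^ 2)) := by
  have hγ₂ : γ ≤ 2 := by linarith
  have hdecel : ∀ᶠ t in atTop, S.decel t < (3 / 2 * γ - 1) / 2 :=
    (h.tendsto_decel hγ).eventually_lt_const (by linarith)
  have hshear : ∀ᶠ t in atTop, ∀ a b, |S.shear t a b / S.hubble t| < (2 - 3 * γ) / 72 := by
    simp only [eventually_all]
    intro a b
    exact (tendsto_zero_iff_abs_tendsto_zero _).1 (h.tendsto_shear_div_hubble hγ a b)
      |>.eventually_lt_const (by linarith)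
  filter_upwards [eventually_ge_atTop t₀, hdecel, hshear] with t ht hq hσ
  have hH := h.hubble_pos hγ₂ ht
  have hnonneg : 0 ≤ S.hubble t * (S.structNormSq t / S.hubble t ^ 2) :=
    mul_nonneg hH.le (div_nonneg (S.structNormSq_nonneg t) (sq_nonneg _))
  have hσ' : ∀ a b, |S.shear t a b| ≤ (2 - 3 * γ) / 72 * S.hubble t := fun a b => by
    have := (hσ a b).le
    rwa [abs_div, abs_of_pos hH, div_le_iff₀ hH] at this
  refine (h.deriv_structNormSq_div_hubble_sq_le hγ₂ ht hσ').trans ?_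
  linarith [mul_le_mul_of_nonneg_right hq.le hnonneg]

lemma tendsto_structNormSq_div_hubble_sq (hγ : γ < 2 / 3) :
    Tendsto (fun t => S.structNormSq t / S.hubble t ^ 2) atTop (𝓝 0) := by
  have hγ₂ : γ ≤ 2 := by linarith
  have hlate := eventually_ge_atTop t₀
  exact tendsto_zero_of_deriv_le_neg_mul (by linarith)
    (hlate.mono fun _ ht => S.hasDerivAt_structNormSq_div_hubble_sq (h.lt_of_le ht)
      (h.hubble_pos hγ₂ ht).ne')
    (hlate.mono fun _ ht => h.hasDerivAt_integral_hubble ht)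
    (h.eventually_deriv_structNormSq_le hγ)
    (Eventually.of_forall fun t => div_nonneg (S.structNormSq_nonneg t) (sq_nonneg _))
    (h.tendsto_integral_hubble hγ₂)

lemma tendsto_structConst_div_hubble (hγ : γ < 2 / 3) (a b c : Fin 3) :
    Tendsto (fun t => structConst S.e t a b c / S.hubble t) atTop (𝓝 0) := by
  have hH : ∀ᶠ t in atTop, S.hubble t ≠ 0 := by
    filter_upwards [eventually_ge_atTop t₀] with t ht
    exact (h.hubble_pos (by linarith) ht).ne'
  refine tendsto_div_zero_of_sq_le_mul_sq (h.tendsto_structNormSq_div_hubble_sq hγ) hH ?_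
  filter_upwards [hH] with t ht
  rw [div_mul_cancel₀ _ (pow_ne_zero 2 ht)]
  exact S.sq_structConst_le_structNormSq t a b c

lemma asymptoticallyQuasiDeSitter (hγ : γ < 2 / 3) :
    S.AsymptoticallyQuasiDeSitter (3 / 2 * γ - 1) where
  accelerating := by linarith
  expanding := by
    filter_upwards [eventually_ge_atTop t₀] with t ht
    exact h.hubble_pos (by linarith) ht
  tendsto_decel := h.tendsto_decel hγ
  tendsto_omegaFluid := h.tendsto_omegaFluid hγ
  tendsto_shear := h.tendsto_shear_div_hubble hγ
  tendsto_structure := h.tendsto_structConst_div_hubble hγ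
  tendsto_form := h.tendsto_form_div_hubble hγ

end IsExpandingOpen

end JFormSpacetime

end Bianchi

theorem theorem2_general {𝔤 : Type*} [LieRing 𝔤] [LieAlgebra ℝ 𝔤] {γ tᵢ : ℝ} (hγ : γ < 2 / 3)
    (S : Bianchi.JFormSpacetime 𝔤 γ tᵢ)
    (t₀ : ℝ) (ht₀ : tᵢ < t₀) (hH : 0 < S.hubble t₀) (hρ : 0 < S.ρ t₀)
    (hK : ∀ t, t₀ ≤ t → Bianchi.spatialCurv (Bianchi.structConst S.e t) ≤ 0) :
    (∀ t, t₀ ≤ t → 0 < S.hubble t) ∧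
    Tendsto (fun t => ∫ s in t₀..t, S.hubble s) atTop atTop ∧
    S.AsymptoticallyQuasiDeSitter (3 / 2 * γ - 1) := by
  have h : S.IsExpandingOpen t₀ := ⟨ht₀, hH, hρ, hK⟩
  have hγ₂ : γ ≤ 2 := by linarith
  exact ⟨fun t => h.hubble_pos hγ₂, h.tendsto_integral_hubble hγ₂,
    h.asymptoticallyQuasiDeSitter hγ⟩

/-- Second no-hair theorem: every initially expanding Bianchi space-time of solvable type
(types I–VII_h) with a `j`-form and a perfect fluid with `0 ≤ γ < 2/3` keeps expanding, the
dimensionless time `τ` with `dτ = H dt` runs to infinity, and the space-time is asymptotically quasi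
de Sitter with `q → 3γ/2 - 1 < 0`. -/
theorem theorem2 {𝔤 : Type*} [LieRing 𝔤] [LieAlgebra ℝ 𝔤] [LieAlgebra.IsSolvable 𝔤]
    {γ tᵢ : ℝ} (hγ₀ : 0 ≤ γ) (hγ : γ < 2 / 3)
    (S : Bianchi.JFormSpacetime 𝔤 γ tᵢ)
    (t₀ : ℝ) (ht₀ : tᵢ < t₀) (hH : 0 < S.hubble t₀) (hρ : 0 < S.ρ t₀) :
    (∀ t, t₀ ≤ t → 0 < S.hubble t) ∧
    Tendsto (fun t => ∫ s in t₀..t, S.hubble s) atTop atTop ∧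
    S.AsymptoticallyQuasiDeSitter (3 / 2 * γ - 1) :=
  theorem2_general hγ S t₀ ht₀ hH hρ fun t _ => Bianchi.spatialCurv_structConst_nonpos S.e t
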